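/- Let $M\ge 2$ be an integer and $\mathbb{H}=\{z\in\mathbb{C}:\operatorname{Im} z>0\}$. For $z_1,\dots,z_M,\lambda\in\mathbb{H}$ and $q\in\mathbb{R}$ put $$\phi(z_1,\dots,z_M,q,\lambda)=\frac{-1}{z_1+\dots+z_M+\lambda-q}\in\mathbb{H}.$$ For $\lambda\in\mathbb{H}$ let $$z_\lambda=-\frac{\lambda}{2M}+\frac1M\sqrt{(\lambda/2)^2-M}\in\mathbb{H}$$ (square root with $\operatorname{Im}\sqrt{\cdot}\ge 0$), the fixed point of $z\mapsto\phi(z,\dots,z,0,\lambda)$ in $\mathbb{H}$, and define the weight $$\mathrm{w}(z)=\mathrm{w}_\lambda(z)=2\bigl(\cosh \operatorname{dist}_{\mathbb{H}}(z,z_\lambda)-1\bigr)=\frac{|z-z_\lambda|^2}{\operatorname{Im}(z)\operatorname{Im}(z_\lambda)}.$$ For $E,\epsilon>0$ let $R(E,\epsilon)=\{\lambda\in\mathbb{H}:\operatorname{Re}\lambda\in[-E,E],\ 0<\operatorname{Im}\lambda\le\epsilon\}$. For $p>0$, $q_1,q_2\in\mathbb{R}$, $\lambda\in\mathbb{H}$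 and $(z_1,\dots,z_{2M-1})\in\mathbb{H}^{2M-1}$ with $\sum_i\mathrm{w}^{1+p}(z_i)>0$ set $$\mu_{3,p}(z_1,\dots,z_{2M-1},q_1,q_2,\lambda)=\sum_{\sigma}\frac{\mathrm{w}^{1+p}\bigl(\phi(\phi(z_{\sigma_1},\dots,z_{\sigma_M},q_1,\lambda),z_{\sigma_{M+1}},\dots,z_{\sigma_{2M-1}},q_2,\lambda)\bigr)}{\mathrm{w}^{1+p}(z_1)+\dots+\mathrm{w}^{1+p}(z_{2M-1})},$$ where $\sigma$ runs over the $2M-1$ cyclic permutations (rotations) of $(1,\dots,2M-1)$. **Lemma.** For every $E$ with $0<E<2\sqrt M$ and every $p$ with $0<p<1$ there exist constants $\epsilon,\eta_1,\epsilon_0>0$ and a compact set $\mathcal{M}\subset\mathbb{H}^{2M-1}$ such that for all $(z_1,\dots,z_{2M-1})\in\mathbb{H}^{2M-1}\setminus\mathcal{M}$, all $q_1,q_2\in[-\eta_1,\eta_1]$ and all $\lambda\in R(E,\epsilon_0)$, the denominator $\sum_i \mathrm{w}^{1+p}(z_i)$ is positive and $$\mu_{3,p}(z_1,\dots,z_{2M-1},q_1,q_2,\lambda)\le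 1-\epsilon .$$ -/

import Mathlib

open scoped UpperHalfPlane

noncomputable section

namespace AndersonTree

/-- The map `φ(z₁, …, z_M, q, λ) = -1 / (z₁ + ⋯ + z_M + λ - q)`, as a map into `ℍ`. -/
def phi {M : ℕ} (z : Fin M → ℍ) (q : ℝ) (lam : ℍ) : ℍ :=
  ⟨-1 / ((∑ i, (z i : ℂ)) + (lam : ℂ) - (q : ℂ)), by
    set w : ℂ := (∑ i, (z i : ℂ)) + (lam : ℂ) - (q : ℂ) with hw
    have him : 0 < w.im := by
      have h1 : w.im = (∑ i, (z i).im) + lam.im := by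
        simp [hw, Complex.im_sum]
      rw [h1]
      have h2 : 0 ≤ ∑ i, (z i).im := Finset.sum_nonneg fun i _ => (z i).im_pos.le
      have h3 := lam.im_pos
      linarith
    have hn : 0 < Complex.normSq w := Complex.normSq_pos.2 fun h => by simp [h] at him
    have h4 : (-1 / w).im = w.im / Complex.normSq w := by
      simp only [Complex.div_im, Complex.neg_im, Complex.neg_re, Complex.one_im, Complex.one_re]
      ring
    rw [h4]
    positivity⟩

/-- The square root with nonnegative imaginary part (and positive on the positive half line). -/
def sqrtUp (a : ℂ) : ℂ :=
  if 0 ≤ a.im then a ^ (1 / 2 : ℂ) else -a ^ (1 / 2 : ℂ)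

/-- `z_λ = -λ / (2M) + (1 / M) √((λ / 2)² - M)`. -/
def zFix (M : ℕ) (lam : ℍ) : ℂ :=
  -(lam : ℂ) / (2 * (M : ℂ)) + 1 / (M : ℂ) * sqrtUp (((lam : ℂ) / 2) ^ 2 - (M : ℂ))

/-- The weight `w(z) = |z - z_λ|² / (Im z · Im z_λ)`. -/
def weight (M : ℕ) (lam : ℍ) (z : ℍ) : ℝ :=
  ‖(z : ℂ) - zFix M lam‖ ^ 2 / (z.im * (zFix M lam).im)

/-- The strip `R(E, ε) = {λ ∈ ℍ : Re λ ∈ [-E, E], 0 < Im λ ≤ ε}`. -/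
def strip (E ε : ℝ) : Set ℍ :=
  {lam | lam.re ∈ Set.Icc (-E) E ∧ lam.im ≤ ε}

/-- `φ(φ(z₁, …, z_M, q₁, λ), z_{M+1}, …, z_{2M-1}, q₂, λ)`; coordinates are numbered from `0`. -/
def phiTwice {M : ℕ} (z : Fin (2 * M - 1) → ℍ) (q₁ q₂ : ℝ) (lam : ℍ) : ℍ :=
  phi (fun j : Fin M =>
    if (j : ℕ) = 0 then phi (fun i : Fin M => z ⟨i, by omega⟩) q₁ lam
    else z ⟨M + j - 1, by omega⟩) q₂ lam

/-- `w^{1+p}(z₁) + ⋯ + w^{1+p}(z_{2M-1})`. -/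
def weightSum (M : ℕ) (p : ℝ) (z : Fin (2 * M - 1) → ℍ) (lam : ℍ) : ℝ :=
  ∑ i, weight M lam (z i) ^ (1 + p)

/-- The quotient `μ_{3,p}`. The sum runs over the `2M - 1` cyclic permutations
`σ = (finRotate (2M - 1)) ^ k`, `0 ≤ k < 2M - 1`. -/
def mu3 (M : ℕ) (p : ℝ) (z : Fin (2 * M - 1) → ℍ) (q₁ q₂ : ℝ) (lam : ℍ) : ℝ :=
  ∑ k ∈ Finset.range (2 * M - 1),
    weight M lam (phiTwice (fun i => z ((finRotate (2 * M - 1) ^ k) i)) q₁ q₂ lam) ^ (1 + p) /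
      weightSum M p z lam

theorem sqrtUp_sq (a : ℂ) : sqrtUp a ^ 2 = a := by
  have h : (a ^ (1 / 2 : ℂ)) ^ 2 = a := by
    have := Complex.cpow_nat_inv_pow a (two_ne_zero)
    simpa only [Nat.cast_ofNat, one_div] using this
  unfold sqrtUp
  split_ifs
  · exact h
  · rw [neg_sq, h]

theorem sqrtUp_im_nonneg (a : ℂ) : 0 ≤ (sqrtUp a).im := by
  rcases eq_or_ne a 0 with rfl | ha
  · simp [sqrtUp]
  have h : (a ^ (1 / 2 : ℂ)).im
      = Real.exp (Real.log ‖a‖ / 2) * Real.sin (a.arg / 2) := by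
    rw [Complex.cpow_def_of_ne_zero ha, Complex.exp_im]
    have e : Complex.log a * (1 / 2) = ((1 / 2 : ℝ) : ℂ) * Complex.log a := by
      push_cast; ring
    rw [e, Complex.re_ofReal_mul, Complex.im_ofReal_mul, Complex.log_re, Complex.log_im]
    ring_nf
  have hpi := Complex.arg_le_pi a
  have hpi' := Complex.neg_pi_lt_arg a
  unfold sqrtUp
  split_ifs with hi
  · rw [h]
    have := Complex.arg_nonneg_iff.2 hi
    exact mul_nonneg (Real.exp_pos _).le
      (Real.sin_nonneg_of_nonneg_of_le_pi (by linarith) (by linarith))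
  · rw [Complex.neg_im, h]
    have := Complex.arg_neg_iff.2 (not_le.1 hi)
    have h2 : Real.sin (a.arg / 2) ≤ 0 :=
      Real.sin_nonpos_of_nonpos_of_neg_pi_le (by linarith) (by linarith)
    have h3 := mul_nonneg (Real.exp_pos (Real.log ‖a‖ / 2)).le (neg_nonneg.2 h2)
    linarith

/-- `z_λ` lies in the upper half plane. -/
theorem zFix_im_pos {M : ℕ} (hM : 0 < M) (lam : ℍ) : 0 < (zFix M lam).im := by
  have hMr : (0 : ℝ) < M := by exact_mod_cast hM
  have hMc : (M : ℂ) ≠ 0 := by exact_mod_cast hM.ne'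
  set s := sqrtUp (((lam : ℂ) / 2) ^ 2 - (M : ℂ)) with hs
  have hsq : s ^ 2 = ((lam : ℂ) / 2) ^ 2 - (M : ℂ) := sqrtUp_sq _
  have hs0 : 0 ≤ s.im := sqrtUp_im_nonneg _
  have hl : 0 < ((lam : ℂ) / 2).im := by
    have := lam.im_pos
    have e : ((lam : ℂ) / 2).im = lam.im / 2 := by simp
    rw [e]; linarith
  set l : ℂ := (lam : ℂ) / 2 with hldef
  have hz : zFix M lam = ((1 / (M : ℝ) : ℝ) : ℂ) * (s - l) := by
    rw [zFix, ← hs, hldef]; push_cast; field_simp; ring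
  have hu : 0 < (s + l).im := by simp only [Complex.add_im]; linarith
  have hu0 : s + l ≠ 0 := fun h => by simp [h] at hu
  have hn : 0 < Complex.normSq (s + l) := Complex.normSq_pos.2 hu0
  have hv : s - l = -((M : ℝ) : ℂ) * (s + l)⁻¹ := by
    rw [eq_mul_inv_iff_mul_eq₀ hu0]
    push_cast
    linear_combination hsq
  have hv' : (s - l).im = M * ((s + l).im / Complex.normSq (s + l)) := by
    rw [hv, ← Complex.ofReal_neg, Complex.im_ofReal_mul, Complex.inv_im]
    ring
  rw [hz, Complex.im_ofReal_mul, hv']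
  positivity

/-- `z_λ` is a fixed point of `z ↦ φ(z, …, z, 0, λ)`. -/
theorem phi_zFix {M : ℕ} (hM : 0 < M) (lam : ℍ) :
    phi (fun _ : Fin M => (⟨zFix M lam, zFix_im_pos hM lam⟩ : ℍ)) 0 lam
      = ⟨zFix M lam, zFix_im_pos hM lam⟩ := by
  have hMc : (M : ℂ) ≠ 0 := by exact_mod_cast hM.ne'
  have hsq := sqrtUp_sq (((lam : ℂ) / 2) ^ 2 - (M : ℂ))
  have hq : zFix M lam * ((M : ℂ) * zFix M lam + lam) = -1 := by
    rw [zFix]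
    generalize sqrtUp (((lam : ℂ) / 2) ^ 2 - (M : ℂ)) = s at hsq ⊢
    field_simp
    linear_combination 4 * hsq
  apply UpperHalfPlane.ext
  simp only [phi, Finset.sum_const, Finset.card_univ, Fintype.card_fin, nsmul_eq_mul,
    Complex.ofReal_zero, sub_zero]
  have h0 : (M : ℂ) * zFix M lam + lam ≠ 0 := fun h => by simp [h] at hq
  exact (div_eq_iff h0).2 hq.symm

/-- `w(z) = 2 (cosh(dist_ℍ(z, z_λ)) - 1)`. -/
theorem weight_eq_cosh {M : ℕ} (hM : 0 < M) (lam z : ℍ) :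
    weight M lam z
      = 2 * (Real.cosh (dist z (⟨zFix M lam, zFix_im_pos hM lam⟩ : ℍ)) - 1) := by
  rw [UpperHalfPlane.cosh_dist, weight, ← dist_eq_norm]
  have h1 := z.im_pos.ne'
  have h2 := (zFix_im_pos hM lam).ne'
  have e : (⟨zFix M lam, zFix_im_pos hM lam⟩ : ℍ).im = (zFix M lam).im := rfl
  rw [e]
  field_simp
  ring

end AndersonTree

end

open scoped UpperHalfPlane
open Filter Topology

noncomputable section

namespace AndersonTree

/-! The proof is by contradiction and compactness. If the bound fails, there are points leaving
every compact set, with `q₁, q₂ → 0` and `λ` tending to a real energy `x`, `|x| ≤ E < 2√M`, along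
which the ratio is asymptotically at least 1. All limits are taken along an ultrafilter, after
dividing the weights by their sum `T → ∞`.

Inversion is a hyperbolic isometry, and `|a|² / y` is jointly convex, so one application of `phi`
gives at most the mean of the incoming weights (`weight_phi_le`), up to a real shift by `q / M` that
is negligible at scale `T`. The limit weight of each rotated `phiTwice` is thus at most a convex
combination of the limits `α i`. Strict convexity of `t ^ (1 + p)`, summed over all rotations, makes
every inequality an equality (`eq_of_sum_rpow_le`): all `α i` agree, and nothing is lost in either
step.

Equality in the mean inequality forces the incoming points of a step to share one limit `b` in the
coordinate `1 / (z - z_λ)`, which is sent to `S + S² b / M`, `S = M z_λ + λ`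
(`exists_tendsto_inv_sub`). Comparing the rotations `k = 0` and `k = 1` shows that this map fixes
`b`. Since the weights diverge, `b` lies on the boundary circle (`boundary_eq`). At the limit energy
the map is elliptic and fixes no boundary point (`no_boundary_fixed_point`). -/

/-! ### Limits along ultrafilters. -/

/-- Along an ultrafilter, a nonnegative function dominated by a convergent one converges. -/
theorem exists_tendsto_of_le {ι : Type*} (U : Ultrafilter ι) {f g : ι → ℝ} {a : ℝ}
    (h0 : ∀ n, 0 ≤ f n) (hfg : ∀ n, f n ≤ g n) (hg : Tendsto g U (𝓝 a)) :
    ∃ b, 0 ≤ b ∧ b ≤ a ∧ Tendsto f U (𝓝 b) := by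
  have hmem : ∀ᶠ n in (U : Filter ι), f n ∈ Set.Icc 0 (a + 1) := by
    filter_upwards [hg.eventually_le_const (lt_add_one a)] with n hn
    exact ⟨h0 n, (hfg n).trans hn⟩
  obtain ⟨b, -, hb⟩ := (isCompact_Icc (a := (0 : ℝ)) (b := a + 1)).ultrafilter_le_nhds
    (U.map f) (le_principal_iff.2 hmem)
  have hb' : Tendsto f U (𝓝 b) := hb
  exact ⟨b, ge_of_tendsto' hb' h0, le_of_tendsto_of_tendsto' hb' hg hfg, hb'⟩

/-- Along an ultrafilter, an eventually bounded complex function converges. -/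
theorem exists_tendsto_of_norm_le {ι : Type*} (U : Ultrafilter ι) {f : ι → ℂ} {R : ℝ}
    (h : ∀ᶠ n in (U : Filter ι), ‖f n‖ ≤ R) : ∃ b, Tendsto f U (𝓝 b) := by
  obtain ⟨b, -, hb⟩ := (isCompact_closedBall (0 : ℂ) R).ultrafilter_le_nhds
    (U.map f) (le_principal_iff.2 (h.mono fun n hn => by simpa using hn))
  exact ⟨b, hb⟩

/-! ### The weight about a general centre and small real translations. -/

/-- The weight `|z - c|² / (Im z · Im c)` with an arbitrary centre `c`. -/
def cweight (c z : ℂ) : ℝ := ‖z - c‖ ^ 2 / (z.im * c.im)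

theorem cweight_nonneg {c z : ℂ} (hc : 0 < c.im) (hz : 0 < z.im) : 0 ≤ cweight c z := by
  unfold cweight; positivity

theorem im_sub_le_norm (c z : ℂ) : c.im - z.im ≤ ‖z - c‖ := by
  have := Complex.abs_im_le_norm (z - c)
  rw [Complex.sub_im] at this
  linarith [neg_abs_le (z.im - c.im)]

/-- Either `Im z ≥ Im c / 2`, or `|z - c| ≥ Im c / 2` and the weight itself is at least of order `1
/ Im z`. -/
theorem inv_im_le {c z : ℂ} (hc : 0 < c.im) (hz : 0 < z.im) :
    1 / z.im ≤ 4 / c.im * (cweight c z + 1) := by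
  have h0 := cweight_nonneg hc hz
  have hw : ‖z - c‖ ^ 2 = cweight c z * (z.im * c.im) := by unfold cweight; field_simp
  rw [div_le_iff₀ hz, div_mul_eq_mul_div, div_mul_eq_mul_div, le_div_iff₀ hc]
  have h1 := im_sub_le_norm c z
  rcases le_total (c.im / 2) z.im with h | h
  · nlinarith
  · have : (c.im / 2) ^ 2 ≤ ‖z - c‖ ^ 2 := pow_le_pow_left₀ (by linarith) (by linarith) 2
    rw [hw] at this
    have h2 : c.im ≤ 4 * (cweight c z * z.im) := by
      by_contra! hcon
      nlinarith
    nlinarith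

/-- Keeps `1 / (z - c)` bounded where the weight is large, so that this coordinate has ultrafilter
limits even when `z → ∞`. -/
theorem half_im_le_norm {c z : ℂ} (hc : 0 < c.im) (hz : 0 < z.im) (h : 1 ≤ cweight c z) :
    c.im / 2 ≤ ‖z - c‖ := by
  have hw : ‖z - c‖ ^ 2 = cweight c z * (z.im * c.im) := by unfold cweight; field_simp
  by_contra! hcon
  have h1 := im_sub_le_norm c z
  have h2 : ‖z - c‖ ^ 2 < (c.im / 2) ^ 2 := pow_lt_pow_left₀ hcon (norm_nonneg _) (by norm_num)
  have h3 : z.im * c.im ≤ ‖z - c‖ ^ 2 := by rw [hw]; nlinarith [mul_pos hz hc]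
  nlinarith

theorem abs_cweight_sub_le {c z : ℂ} (hc : 0 < c.im) (hz : 0 < z.im) (q : ℝ) :
    |cweight c (z - q) - cweight c z| ≤
      |q| * cweight c z + (|q| + q ^ 2) * (4 / c.im ^ 2) * (cweight c z + 1) := by
  have him : (z - (q : ℂ)).im = z.im := by simp
  have e : z - (q : ℂ) - c = (z - c) - q := by ring
  have hn : ‖(q : ℂ)‖ = |q| := by simp
  have h1 : |‖z - (q : ℂ) - c‖ ^ 2 - ‖z - c‖ ^ 2| ≤ |q| * ‖z - c‖ ^ 2 + (|q| + q ^ 2) := by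
    have ha := abs_norm_sub_norm_le (z - (q : ℂ) - c) (z - c)
    rw [show z - (q : ℂ) - c - (z - c) = -q by ring, norm_neg, hn] at ha
    rw [abs_le] at ha
    have hq := abs_nonneg q
    have hq2 := sq_abs q
    have h0 := norm_nonneg (z - (q : ℂ) - c)
    have h0' := norm_nonneg (z - c)
    rw [abs_le]
    generalize ‖z - (q : ℂ) - c‖ = s at *
    generalize ‖z - c‖ = t at *
    generalize |q| = r at *
    rw [← hq2]
    obtain ⟨h2, h3⟩ := ha
    -- The cross term is absorbed by `2t ≤ t² + 1`, leaving an error proportional to the weight plus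
    -- a constant.
    have h4 : 2 * (r * t) ≤ r * t ^ 2 + r := by nlinarith [mul_nonneg hq (sq_nonneg (t - 1))]
    constructor
    · rcases le_total r t with h | h
      · nlinarith [mul_nonneg (by linarith : 0 ≤ s - (t - r)) (by linarith : 0 ≤ s + (t - r))]
      · nlinarith [sq_nonneg s, mul_nonneg (sub_nonneg.2 h) h0']
    · nlinarith [mul_nonneg (by linarith : 0 ≤ t + r - s) (by linarith : 0 ≤ t + r + s)]
  have h2 := inv_im_le hc hz
  have hd : 0 < z.im * c.im := mul_pos hz hc
  unfold cweight at h2 ⊢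
  rw [him, ← sub_div, abs_div, abs_of_pos hd]
  calc _ ≤ (|q| * ‖z - c‖ ^ 2 + (|q| + q ^ 2)) / (z.im * c.im) := by gcongr
    _ = |q| * (‖z - c‖ ^ 2 / (z.im * c.im)) + (|q| + q ^ 2) * (1 / c.im) * (1 / z.im) := by
        field_simp
    _ ≤ |q| * (‖z - c‖ ^ 2 / (z.im * c.im)) + (|q| + q ^ 2) * (1 / c.im) *
          (4 / c.im * (‖z - c‖ ^ 2 / (z.im * c.im) + 1)) := by gcongr
    _ = _ := by field_simp

/-- A vanishing real translation does not change the weight to leading order. -/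
theorem tendsto_cweight_sub_div {ι : Type*} {l : Filter ι} {c z : ι → ℂ} {q T : ι → ℝ} {cL : ℂ}
    {α : ℝ} (hc : Tendsto c l (𝓝 cL)) (hcL : 0 < cL.im) (hcp : ∀ n, 0 < (c n).im)
    (hz : ∀ n, 0 < (z n).im) (hq : Tendsto q l (𝓝 0)) (hT : Tendsto T l atTop)
    (hw : Tendsto (fun n => cweight (c n) (z n) / T n) l (𝓝 α)) :
    Tendsto (fun n => cweight (c n) (z n - q n) / T n) l (𝓝 α) := by
  have hci : Tendsto (fun n => (c n).im) l (𝓝 cL.im) :=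
    (Complex.continuous_im.tendsto _).comp hc
  have hqa : Tendsto (fun n => |q n|) l (𝓝 0) := by simpa using hq.abs
  have hTi := tendsto_inv_atTop_zero.comp hT
  have hb : Tendsto (fun n => |q n| * (cweight (c n) (z n) / T n) + (|q n| + q n ^ 2) *
      (4 / (c n).im ^ 2) * (cweight (c n) (z n) / T n + (T n)⁻¹)) l
      (𝓝 (0 * α + (0 + 0 ^ 2) * (4 / cL.im ^ 2) * (α + 0))) :=
    (hqa.mul hw).add (((hqa.add (hq.pow 2)).mul
      (tendsto_const_nhds.div (hci.pow 2) (by positivity))).mul (hw.add hTi))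
  have hd : Tendsto (fun n => cweight (c n) (z n - q n) / T n - cweight (c n) (z n) / T n) l
      (𝓝 0) := by
    refine squeeze_zero_norm' ?_ (by simpa using hb)
    filter_upwards [hT.eventually_gt_atTop 0] with n hn
    rw [← sub_div, norm_div, Real.norm_eq_abs, Real.norm_eq_abs, abs_of_pos hn]
    calc _ ≤ _ := div_le_div_of_nonneg_right (abs_cweight_sub_le (hcp n) (hz n) (q n)) hn.le
      _ = _ := by field_simp
  simpa using hd.add hw

/-! ### One application of `phi`: exact formulas and the mean inequality. -/

/-- Inversion is an isometry fixing the point `c` with `c · Sc = -1`. -/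
theorem cweight_neg_inv {c S Sc : ℂ} (hcS : c * Sc = -1) (hS : S ≠ 0) :
    cweight c (-1 / S) = ‖S - Sc‖ ^ 2 / (S.im * Sc.im) := by
  have hSc : Sc ≠ 0 := fun h => by simp [h] at hcS
  have hc : c = -1 / Sc := by rw [eq_div_iff hSc, hcS]
  have hi : ∀ w : ℂ, (-1 / w).im = w.im / ‖w‖ ^ 2 := fun w => by
    rw [← Complex.normSq_eq_norm_sq, neg_div, one_div, Complex.neg_im, Complex.inv_im]; ring
  have hn : ‖-1 / S - c‖ = ‖S - Sc‖ / (‖S‖ * ‖Sc‖) := by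
    rw [hc, ← norm_mul, ← norm_div]; congr 1; field_simp; ring
  have h1 : ‖S‖ ≠ 0 := norm_ne_zero_iff.2 hS
  have h2 : ‖Sc‖ ≠ 0 := norm_ne_zero_iff.2 hSc
  rw [cweight, hn, hi, hc, hi]
  field_simp

/-- A variance identity: the quotient of the sums is the mean of the `a i / y i` with weights `y i`.
It gives Cauchy–Schwarz with an explicit defect. -/
theorem sum_norm_sq_sub {κ : Type*} [Fintype κ] (a : κ → ℂ) (y : κ → ℝ) (hy : ∀ i, 0 < y i)
    (hY : 0 < ∑ i, y i) :
    ∑ i, y i * ‖a i / y i - (∑ j, a j) / (∑ j, y j : ℝ)‖ ^ 2 =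
      (∑ i, ‖a i‖ ^ 2 / y i) - ‖∑ i, a i‖ ^ 2 / ∑ i, y i := by
  set A := ∑ i, a i with hA
  set Y := ∑ i, y i with hYd
  have key : ∀ i, y i * ‖a i / y i - A / (Y : ℂ)‖ ^ 2 =
      ‖a i‖ ^ 2 / y i - 2 / Y * ((a i).re * A.re + (a i).im * A.im) + y i * (‖A‖ ^ 2 / Y ^ 2) := by
    intro i
    have := (hy i).ne'
    simp only [← Complex.normSq_eq_norm_sq, Complex.normSq_apply, Complex.sub_re, Complex.sub_im,
      Complex.div_ofReal_re, Complex.div_ofReal_im]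
    field_simp
    ring
  have hre : ∑ i, (a i).re = A.re := by rw [hA, Complex.re_sum]
  have him : ∑ i, (a i).im = A.im := by rw [hA, Complex.im_sum]
  simp_rw [key]
  rw [Finset.sum_add_distrib, Finset.sum_sub_distrib, ← Finset.mul_sum, Finset.sum_add_distrib,
    ← Finset.sum_mul, ← Finset.sum_mul, ← Finset.sum_mul, hre, him, ← hYd,
    ← Complex.normSq_eq_norm_sq, Complex.normSq_apply]
  field_simp
  ring

theorem zFix_mul {M : ℕ} (hM : 0 < M) (lam : ℍ) :
    zFix M lam * ((M : ℂ) * zFix M lam + lam) = -1 := by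
  have h := congrArg UpperHalfPlane.coe (phi_zFix hM lam)
  simp only [phi, Finset.sum_const, Finset.card_univ, Fintype.card_fin, nsmul_eq_mul,
    Complex.ofReal_zero, sub_zero] at h
  have h0 : (M : ℂ) * zFix M lam + lam ≠ 0 := fun h0 => by
    have h1 := zFix_im_pos hM lam
    rw [← h, h0] at h1
    simp at h1
  exact ((div_eq_iff h0).1 h).symm

section step

variable {M : ℕ} (hM : 0 < M) (z : Fin M → ℍ) (q : ℝ) (lam : ℍ)

theorem weight_eq_cweight (w : ℍ) : weight M lam w = cweight (zFix M lam) w := rfl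

/-- The sum of the displacements `z_i - q / M - z_λ`. -/
def dispSum : ℂ := ∑ i, ((z i : ℂ) - ((q / M : ℝ) : ℂ) - zFix M lam)

theorem im_arg : ((∑ i, (z i : ℂ)) + lam - q).im = (∑ i, (z i).im) + lam.im := by
  simp [Complex.im_sum]

include hM

theorem dispSum_eq : dispSum z q lam =
    ((∑ i, (z i : ℂ)) + lam - q) - ((M : ℂ) * zFix M lam + lam) := by
  have hMc : (M : ℂ) ≠ 0 := by exact_mod_cast hM.ne'
  simp only [dispSum, Finset.sum_sub_distrib, Finset.sum_const, Finset.card_univ,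
    Fintype.card_fin, nsmul_eq_mul]
  push_cast
  field_simp
  ring

theorem sum_im_pos : 0 < ∑ i, (z i).im := by
  have : Nonempty (Fin M) := ⟨⟨0, hM⟩⟩
  exact Finset.sum_pos (fun i _ => (z i).im_pos) Finset.univ_nonempty

theorem arg_ne_zero : (∑ i, (z i : ℂ)) + lam - q ≠ 0 := fun h => by
  have h1 := im_arg z q lam
  rw [h, Complex.zero_im] at h1
  linarith [sum_im_pos hM z, lam.im_pos]

theorem weight_phi : weight M lam (phi z q lam) =
    ‖dispSum z q lam‖ ^ 2 / (((∑ i, (z i).im) + lam.im) * (M * (zFix M lam).im + lam.im)) := by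
  rw [weight_eq_cweight]
  simp only [phi]
  rw [cweight_neg_inv (zFix_mul hM lam) (arg_ne_zero hM z q lam), im_arg, dispSum_eq hM]
  congr 2
  simp

/-- In the coordinate `1 / (w - z_λ)`, which sends the fixed point to infinity, the inversion
becomes affine in `1 / dispSum`. -/
theorem inv_phi_sub (h : dispSum z q lam ≠ 0) : 1 / ((phi z q lam : ℂ) - zFix M lam) =
    ((M : ℂ) * zFix M lam + lam) + ((M : ℂ) * zFix M lam + lam) ^ 2 / dispSum z q lam := by
  have hA := dispSum_eq hM z q lam
  have h0 := arg_ne_zero hM z q lam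
  have hf := zFix_mul hM lam
  simp only [phi]
  generalize (∑ i, (z i : ℂ)) + lam - q = S at *
  generalize (M : ℂ) * zFix M lam + lam = R at *
  have hR : R ≠ 0 := fun h => by simp [h] at hf
  have hc : zFix M lam = -1 / R := by rw [eq_div_iff hR, hf]
  have e : -1 / S - zFix M lam = dispSum z q lam / (S * R) := by
    rw [hc, hA]; field_simp; ring
  rw [e, show S = dispSum z q lam + R by rw [hA]; ring]
  field_simp

theorem mul_weight_phi_le :
    M * (zFix M lam).im * weight M lam (phi z q lam) ≤ ‖dispSum z q lam‖ ^ 2 / ∑ i, (z i).im := by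
  have h1 := sum_im_pos hM z
  have h2 := lam.im_pos
  have h3 := zFix_im_pos hM lam
  have h4 : (0 : ℝ) < M := by exact_mod_cast hM
  rw [weight_phi hM, mul_div_assoc', div_le_div_iff₀ (by positivity) h1]
  have : M * (zFix M lam).im * ∑ i, (z i).im ≤
      ((∑ i, (z i).im) + lam.im) * (M * (zFix M lam).im + lam.im) := by
    nlinarith [mul_pos h1 h2, mul_pos h2 h2, mul_pos (mul_pos h4 h3) h2]
  nlinarith [sq_nonneg ‖dispSum z q lam‖]

theorem sum_defect : ∑ i, (z i).im * ‖((z i : ℂ) - ((q / M : ℝ) : ℂ) - zFix M lam) / (z i).im -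
      dispSum z q lam / (∑ j, (z j).im : ℝ)‖ ^ 2 =
    (zFix M lam).im * (∑ i, cweight (zFix M lam) (z i - ((q / M : ℝ) : ℂ))) -
      ‖dispSum z q lam‖ ^ 2 / ∑ i, (z i).im := by
  have h3 := zFix_im_pos hM lam
  rw [dispSum, sum_norm_sq_sub _ _ (fun i => (z i).im_pos) (sum_im_pos hM z), Finset.mul_sum]
  congr 1
  refine Finset.sum_congr rfl fun i _ => ?_
  have := (z i).im_pos
  have e : ((z i : ℂ) - ((q / M : ℝ) : ℂ)).im = (z i).im := by
    rw [Complex.sub_im, Complex.ofReal_im, sub_zero]; rfl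
  rw [cweight, e]
  field_simp

theorem weight_phi_le :
    M * weight M lam (phi z q lam) ≤ ∑ i, cweight (zFix M lam) (z i - ((q / M : ℝ) : ℂ)) := by
  have h1 := mul_weight_phi_le hM z q lam
  have h2 := sum_defect hM z q lam
  have h3 := zFix_im_pos hM lam
  have h4 : 0 ≤ ∑ i, (z i).im * ‖((z i : ℂ) - ((q / M : ℝ) : ℂ) - zFix M lam) / (z i).im -
      dispSum z q lam / (∑ j, (z j).im : ℝ)‖ ^ 2 :=
    Finset.sum_nonneg fun i _ => mul_nonneg (z i).im_pos.le (sq_nonneg _)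
  nlinarith

/-- The conjugate inverse displacement of each point is close to a common value. -/
theorem norm_sq_sub_le {T : ℝ} (hT : 0 < T) (i : Fin M)
    (hw : 0 < cweight (zFix M lam) (z i - ((q / M : ℝ) : ℂ))) :
    ‖(starRingEnd ℂ) (1 / ((z i : ℂ) - ((q / M : ℝ) : ℂ) - zFix M lam)) -
        dispSum z q lam / (((∑ j, (z j).im) * (zFix M lam).im * T : ℝ) : ℂ) *
          ((T / cweight (zFix M lam) (z i - ((q / M : ℝ) : ℂ)) : ℝ) : ℂ)‖ ^ 2 ≤
      ‖1 / ((z i : ℂ) - ((q / M : ℝ) : ℂ) - zFix M lam)‖ ^ 2 *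
        (((∑ i, cweight (zFix M lam) (z i - ((q / M : ℝ) : ℂ))) -
          M * weight M lam (phi z q lam)) / cweight (zFix M lam) (z i - ((q / M : ℝ) : ℂ))) := by
  have h1 := mul_weight_phi_le hM z q lam
  have h2 := sum_defect hM z q lam
  have h3 := zFix_im_pos hM lam
  have hy := (z i).im_pos
  have hs := sum_im_pos hM z
  have h4 := Finset.single_le_sum (f := fun i => (z i).im *
      ‖((z i : ℂ) - ((q / M : ℝ) : ℂ) - zFix M lam) / (z i).im -
      dispSum z q lam / (∑ j, (z j).im : ℝ)‖ ^ 2)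
    (fun i _ => mul_nonneg (z i).im_pos.le (sq_nonneg _)) (Finset.mem_univ i)
  have e : ((z i : ℂ) - ((q / M : ℝ) : ℂ)).im = (z i).im := by
    rw [Complex.sub_im, Complex.ofReal_im, sub_zero]; rfl
  have hwe : cweight (zFix M lam) (z i - ((q / M : ℝ) : ℂ)) =
      ‖(z i : ℂ) - ((q / M : ℝ) : ℂ) - zFix M lam‖ ^ 2 / ((z i).im * (zFix M lam).im) := by
    rw [cweight, e]
  rw [h2] at h4
  generalize (∑ i, cweight (zFix M lam) (z i - ((q / M : ℝ) : ℂ))) = W at *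
  generalize cweight (zFix M lam) (z i - ((q / M : ℝ) : ℂ)) = w at *
  generalize (z i : ℂ) - ((q / M : ℝ) : ℂ) - zFix M lam = a at *
  generalize (zFix M lam).im = Y at *
  generalize (∑ i, (z i).im) = s at *
  generalize (z i).im = y at *
  generalize dispSum z q lam = A at *
  have ha : a ≠ 0 := fun h => by simp [h] at hwe; exact hw.ne' hwe
  have hna : ‖a‖ ≠ 0 := norm_ne_zero_iff.2 ha
  have hconj : (starRingEnd ℂ) (1 / a) = a / ((‖a‖ ^ 2 : ℝ) : ℂ) := by
    rw [map_div₀, map_one, div_eq_div_iff (by simpa using ha) (by exact_mod_cast pow_ne_zero 2 hna),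
      ← Complex.normSq_eq_norm_sq, Complex.normSq_eq_conj_mul_self]
    ring
  have ha2 : ‖a‖ ^ 2 = w * y * Y := by rw [hwe]; field_simp
  -- Since `conj (1 / a) = a / |a|²` and `|a|² = w y Y`, the difference is a multiple of the
  -- deviation `a / y - A / s`, which the defect controls.
  have hfac : (starRingEnd ℂ) (1 / a) - A / ((s * Y * T : ℝ) : ℂ) * ((T / w : ℝ) : ℂ) =
      ((1 / (w * Y) : ℝ) : ℂ) * (a / y - A / s) := by
    rw [hconj, ha2]
    have : (w : ℂ) ≠ 0 := by exact_mod_cast hw.ne'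
    have : (Y : ℂ) ≠ 0 := by exact_mod_cast h3.ne'
    have : (y : ℂ) ≠ 0 := by exact_mod_cast hy.ne'
    have : (s : ℂ) ≠ 0 := by exact_mod_cast hs.ne'
    have : (T : ℂ) ≠ 0 := by exact_mod_cast hT.ne'
    push_cast
    field_simp
  rw [hfac, norm_mul, mul_pow, norm_div, norm_one, div_pow, ha2, Complex.norm_real,
    Real.norm_of_nonneg (by positivity)]
  have h5 : y * ‖a / y - A / s‖ ^ 2 ≤ Y * (W - M * weight M lam (phi z q lam)) := by linarith
  calc _ = (y * ‖a / y - A / s‖ ^ 2) * (1 / (w ^ 2 * Y ^ 2 * y)) := by field_simp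
    _ ≤ Y * (W - M * weight M lam (phi z q lam)) * (1 / (w ^ 2 * Y ^ 2 * y)) := by gcongr
    _ = _ := by field_simp

end step

/-! ### Asymptotics of one step and its equality case. -/

theorem tendsto_atTop_of_tendsto_div {ι : Type*} {l : Filter ι} {f T : ι → ℝ} {α : ℝ}
    (hα : 0 < α) (hT : Tendsto T l atTop) (h : Tendsto (fun n => f n / T n) l (𝓝 α)) :
    Tendsto f l atTop := by
  refine (h.pos_mul_atTop hα hT).congr' ?_
  filter_upwards [hT.eventually_gt_atTop 0] with n hn
  field_simp

theorem tendsto_inv_add {ι : Type*} {l : Filter ι} {a d : ι → ℂ} {b : ℂ}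
    (hd : Tendsto d l (𝓝 0)) (ha : Tendsto (fun n => 1 / a n) l (𝓝 b))
    (ha0 : ∀ᶠ n in l, a n ≠ 0) : Tendsto (fun n => 1 / (a n + d n)) l (𝓝 b) := by
  have h := ha.div ((tendsto_const_nhds (x := (1 : ℂ))).add (hd.mul ha)) (by simp)
  simp only [zero_mul, add_zero, div_one] at h
  refine h.congr' ?_
  filter_upwards [ha0] with n hn
  simp only [Pi.div_apply]
  rw [div_div]
  congr 1
  field_simp

section limits

variable {ι : Type*} {U : Ultrafilter ι} {M : ℕ} {z : ι → Fin M → ℍ} {q T : ι → ℝ} {lam : ι → ℍ}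
  {cL : ℂ}

theorem tendsto_shift (hM : 0 < M) (hc : Tendsto (fun n => zFix M (lam n)) U (𝓝 cL))
    (hcL : 0 < cL.im) (hq : Tendsto q U (𝓝 0)) (hT : Tendsto T U atTop) {i : Fin M} {α : ℝ}
    (hw : Tendsto (fun n => weight M (lam n) (z n i) / T n) U (𝓝 α)) :
    Tendsto (fun n => cweight (zFix M (lam n)) (z n i - ((q n / M : ℝ) : ℂ)) / T n) U (𝓝 α) :=
  tendsto_cweight_sub_div hc hcL (fun n => zFix_im_pos hM (lam n)) (fun n => (z n i).im_pos)
    (by simpa using hq.div_const (M : ℝ)) hT hw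

theorem exists_tendsto_weight_phi (hM : 0 < M)
    (hc : Tendsto (fun n => zFix M (lam n)) U (𝓝 cL)) (hcL : 0 < cL.im)
    (hq : Tendsto q U (𝓝 0)) (hT0 : ∀ n, 0 ≤ T n) (hT : Tendsto T U atTop) {α : Fin M → ℝ}
    (hw : ∀ i, Tendsto (fun n => weight M (lam n) (z n i) / T n) U (𝓝 (α i))) :
    ∃ ν, 0 ≤ ν ∧ ν ≤ (1 / M) * ∑ i, α i ∧
      Tendsto (fun n => weight M (lam n) (phi (z n) (q n) (lam n)) / T n) U (𝓝 ν) := by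
  have hMr : (0 : ℝ) < M := by exact_mod_cast hM
  have h := (tendsto_finsetSum Finset.univ fun i _ =>
    tendsto_shift hM hc hcL hq hT (hw i)).const_mul (1 / (M : ℝ))
  refine exists_tendsto_of_le U (fun n => ?_) (fun n => ?_) h
  · exact div_nonneg (cweight_nonneg (zFix_im_pos hM _) (phi (z n) (q n) (lam n)).im_pos) (hT0 n)
  · rw [← Finset.sum_div, mul_div_assoc']
    refine div_le_div_of_nonneg_right ?_ (hT0 n)
    have := weight_phi_le hM (z n) (q n) (lam n)
    rw [one_div, ← div_eq_inv_mul, le_div_iff₀ hMr]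
    linarith

/-- The equality case of the mean inequality: with no weight lost at scale `T`, the variance defect
vanishes relative to `T`, so the incoming points coalesce in the coordinate `1 / (z - z_λ)`. -/
theorem exists_tendsto_inv_sub (hM : 0 < M)
    (hc : Tendsto (fun n => zFix M (lam n)) U (𝓝 cL)) (hcL : 0 < cL.im)
    (hq : Tendsto q U (𝓝 0)) (hT : Tendsto T U atTop) {α : ℝ} (hα : 0 < α)
    (hw : ∀ i, Tendsto (fun n => weight M (lam n) (z n i) / T n) U (𝓝 α))
    (hφ : Tendsto (fun n => weight M (lam n) (phi (z n) (q n) (lam n)) / T n) U (𝓝 α))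
    {lL : ℂ} (hlam : Tendsto (fun n => (lam n : ℂ)) U (𝓝 lL)) :
    ∃ b, (∀ i, Tendsto (fun n => 1 / ((z n i : ℂ) - zFix M (lam n))) U (𝓝 b)) ∧
      Tendsto (fun n => 1 / ((phi (z n) (q n) (lam n) : ℂ) - zFix M (lam n))) U
        (𝓝 ((M * cL + lL) + (M * cL + lL) ^ 2 * (b / M))) := by
  have hMr : (0 : ℝ) < M := by exact_mod_cast hM
  have hMc : (M : ℂ) ≠ 0 := by exact_mod_cast hM.ne'
  set w : ι → Fin M → ℝ := fun n i => cweight (zFix M (lam n)) (z n i - ((q n / M : ℝ) : ℂ))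
    with hwdef
  set β : ι → Fin M → ℂ := fun n i => 1 / ((z n i : ℂ) - ((q n / M : ℝ) : ℂ) - zFix M (lam n))
    with hβdef
  set s : ι → ℝ := fun n => (∑ j, (z n j).im) * (zFix M (lam n)).im * T n with hsdef
  set C : ι → ℂ := fun n => dispSum (z n) (q n) (lam n) / (s n : ℂ) with hCdef
  have hw' : ∀ i, Tendsto (fun n => w n i / T n) U (𝓝 α) := fun i =>
    tendsto_shift hM hc hcL hq hT (hw i)
  have hw1 : ∀ i, ∀ᶠ n in (U : Filter ι), 1 ≤ w n i := fun i =>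
    (tendsto_atTop_of_tendsto_div hα hT (hw' i)).eventually_ge_atTop 1
  have hT0 : ∀ᶠ n in (U : Filter ι), 0 < T n := hT.eventually_gt_atTop 0
  have hci : ∀ᶠ n in (U : Filter ι), cL.im / 2 < (zFix M (lam n)).im :=
    ((Complex.continuous_im.tendsto _).comp hc).eventually_const_lt (by simpa using half_lt_self hcL)
  have hnorm : ∀ i, ∀ᶠ n in (U : Filter ι),
      cL.im / 4 ≤ ‖(z n i : ℂ) - ((q n / M : ℝ) : ℂ) - zFix M (lam n)‖ := fun i => by
    filter_upwards [hw1 i, hci] with n h1 h2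
    have := half_im_le_norm (zFix_im_pos hM (lam n)) (z := z n i - ((q n / M : ℝ) : ℂ))
      (by rw [Complex.sub_im, Complex.ofReal_im, sub_zero]; exact (z n i).im_pos) h1
    linarith
  have hβ : ∀ i, ∃ b, Tendsto (fun n => β n i) U (𝓝 b) := fun i => by
    refine exists_tendsto_of_norm_le U (R := 1 / (cL.im / 4)) ?_
    filter_upwards [hnorm i] with n h
    rw [hβdef, norm_div, norm_one]
    gcongr
  choose b hb using hβ
  have hdef : Tendsto (fun n => ((∑ i, w n i) - M * weight M (lam n) (phi (z n) (q n) (lam n))) / T n)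
      U (𝓝 0) := by
    have h := (tendsto_finsetSum Finset.univ fun i _ => hw' i).sub (hφ.const_mul (M : ℝ))
    simp only [Finset.sum_const, Finset.card_univ, Fintype.card_fin, nsmul_eq_mul, sub_self] at h
    refine h.congr fun n => ?_
    rw [← Finset.sum_div, sub_div, mul_div_assoc]
  -- `C` does not depend on `i`, so uniqueness of its limit identifies all the `b i`.
  have hC : ∀ i, Tendsto C U (𝓝 ((starRingEnd ℂ) (b i) * α)) := fun i => by
    have h1 : Tendsto (fun n => ‖β n i‖ ^ 2 *
        (((∑ i, w n i) - M * weight M (lam n) (phi (z n) (q n) (lam n))) / w n i)) U (𝓝 0) := by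
      have h := ((hb i).norm.pow 2).mul (hdef.div (hw' i) hα.ne')
      rw [zero_div, mul_zero] at h
      refine h.congr' ?_
      filter_upwards [hT0, hw1 i] with n hn hn1
      simp only [Pi.div_apply]
      rw [div_div_div_cancel_right₀ hn.ne']
    have h2 : Tendsto (fun n => (starRingEnd ℂ) (β n i) - C n * ((T n / w n i : ℝ) : ℂ)) U
        (𝓝 0) := by
      have h3 : Tendsto (fun n => ‖(starRingEnd ℂ) (β n i) - C n * ((T n / w n i : ℝ) : ℂ)‖ ^ 2) U
          (𝓝 0) := by
        refine squeeze_zero' (Eventually.of_forall fun n => sq_nonneg _) ?_ h1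
        filter_upwards [hT0, hw1 i] with n hn hn1
        exact norm_sq_sub_le hM (z n) (q n) (lam n) hn i (lt_of_lt_of_le one_pos hn1)
      have h4 := h3.sqrt
      simp only [Real.sqrt_zero, Real.sqrt_sq (norm_nonneg _)] at h4
      exact tendsto_zero_iff_norm_tendsto_zero.2 h4
    have h5 := (((Complex.continuous_conj.tendsto _).comp (hb i)).sub h2).mul
      ((Complex.continuous_ofReal.tendsto _).comp (hw' i))
    rw [sub_zero] at h5
    refine h5.congr' ?_
    filter_upwards [hT0, hw1 i] with n hn hn1
    have e1 : (T n : ℂ) ≠ 0 := by exact_mod_cast hn.ne'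
    have e2 : (w n i : ℂ) ≠ 0 := by
      exact_mod_cast (lt_of_lt_of_le one_pos hn1).ne'
    simp only [Function.comp_apply]
    push_cast
    field_simp
    ring
  have hαc : (α : ℂ) ≠ 0 := by exact_mod_cast hα.ne'
  have hbb : ∀ i, b i = b ⟨0, hM⟩ := fun i => by
    have h := tendsto_nhds_unique (hC i) (hC ⟨0, hM⟩)
    exact (starRingEnd ℂ).injective (mul_right_cancel₀ hαc h)
  -- Squeezed between `M` times the outgoing weight and the sum of the shifted incoming weights,
  -- both divided by `T`.
  have hA : Tendsto (fun n => ‖dispSum (z n) (q n) (lam n)‖ ^ 2 / s n) U (𝓝 (M * α)) := by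
    refine tendsto_of_tendsto_of_tendsto_of_le_of_le' (hφ.const_mul (M : ℝ))
      (by simpa using (tendsto_finsetSum Finset.univ fun i _ => hw' i)) ?_ ?_
    · filter_upwards [hT0] with n hn
      have h1 := mul_weight_phi_le hM (z n) (q n) (lam n)
      have h2 := zFix_im_pos hM (lam n)
      have h3 := sum_im_pos hM (z n)
      rw [hsdef]
      calc _ = M * (zFix M (lam n)).im * weight M (lam n) (phi (z n) (q n) (lam n)) *
            (1 / ((zFix M (lam n)).im * T n)) := by field_simp
        _ ≤ ‖dispSum (z n) (q n) (lam n)‖ ^ 2 / (∑ i, (z n i).im) *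
            (1 / ((zFix M (lam n)).im * T n)) := by gcongr
        _ = _ := by field_simp
    · filter_upwards [hT0] with n hn
      have h1 := sum_defect hM (z n) (q n) (lam n)
      have h2 := zFix_im_pos hM (lam n)
      have h3 := sum_im_pos hM (z n)
      have h4 : ‖dispSum (z n) (q n) (lam n)‖ ^ 2 / ∑ i, (z n i).im ≤
          (zFix M (lam n)).im * ∑ i, w n i := by
        have : 0 ≤ ∑ i, (z n i).im * ‖((z n i : ℂ) - ((q n / M : ℝ) : ℂ) - zFix M (lam n)) /
            (z n i).im - dispSum (z n) (q n) (lam n) / (∑ j, (z n j).im : ℝ)‖ ^ 2 :=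
          Finset.sum_nonneg fun i _ => mul_nonneg (z n i).im_pos.le (sq_nonneg _)
        linarith
      rw [← Finset.sum_div, hsdef]
      calc _ = ‖dispSum (z n) (q n) (lam n)‖ ^ 2 / (∑ i, (z n i).im) *
            (1 / ((zFix M (lam n)).im * T n)) := by field_simp
        _ ≤ (zFix M (lam n)).im * (∑ i, w n i) * (1 / ((zFix M (lam n)).im * T n)) := by gcongr
        _ = _ := by field_simp
  have hs0 : ∀ᶠ n in (U : Filter ι), s n ≠ 0 := by
    filter_upwards [hT0] with n hn
    exact (mul_pos (mul_pos (sum_im_pos hM (z n)) (zFix_im_pos hM (lam n))) hn).ne'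
  -- With `A` for `dispSum`, `1 / A = conj A / |A|²` is the quotient of `conj C` by the quantity in
  -- `hA`.
  have hinvA : Tendsto (fun n => 1 / dispSum (z n) (q n) (lam n)) U (𝓝 (b ⟨0, hM⟩ / M)) := by
    have h := ((Complex.continuous_conj.tendsto _).comp (hC ⟨0, hM⟩)).div
      ((Complex.continuous_ofReal.tendsto _).comp hA) (by push_cast; exact mul_ne_zero hMc hαc)
    have e : (starRingEnd ℂ) ((starRingEnd ℂ) (b ⟨0, hM⟩) * α) / ((M * α : ℝ) : ℂ) =
        b ⟨0, hM⟩ / M := by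
      simp only [map_mul, Complex.conj_conj, Complex.conj_ofReal]
      push_cast
      field_simp
    rw [e] at h
    refine h.congr' ?_
    filter_upwards [hs0] with n hn
    have hn' : (s n : ℂ) ≠ 0 := by exact_mod_cast hn
    simp only [Pi.div_apply, Function.comp_apply, hCdef, map_div₀, Complex.conj_ofReal]
    rw [one_div, Complex.inv_def, Complex.normSq_eq_norm_sq]
    push_cast
    rw [div_div_div_cancel_right₀ hn', div_eq_mul_inv]
  have hA0 : ∀ᶠ n in (U : Filter ι), dispSum (z n) (q n) (lam n) ≠ 0 := by
    filter_upwards [hA.eventually_const_lt (mul_pos hMr hα)] with n hn h0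
    simp [h0] at hn
  refine ⟨b ⟨0, hM⟩, fun i => ?_, ?_⟩
  · have hq' : Tendsto (fun n => ((q n / M : ℝ) : ℂ)) U (𝓝 0) := by
      have := (Complex.continuous_ofReal.tendsto _).comp (hq.div_const (M : ℝ))
      simpa [Function.comp_def] using this
    have h := tendsto_inv_add hq' (hbb i ▸ hb i) (by
      filter_upwards [hnorm i] with n hn h0
      rw [h0, norm_zero] at hn
      linarith)
    refine h.congr fun n => ?_
    congr 1
    ring
  · have hS : Tendsto (fun n => (M : ℂ) * zFix M (lam n) + lam n) U (𝓝 (M * cL + lL)) :=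
      (hc.const_mul _).add hlam
    refine (hS.add ((hS.pow 2).mul hinvA)).congr' ?_
    filter_upwards [hA0] with n hn
    rw [inv_phi_sub hM _ _ _ hn, mul_one_div]

/-- A limit of `1 / (z - z_λ)` along which the weight diverges lies on the boundary circle. -/
theorem boundary_eq {c w : ι → ℂ} {b : ℂ} (hc : Tendsto c U (𝓝 cL)) (hcL : 0 < cL.im)
    (hcp : ∀ n, 0 < (c n).im) (hwp : ∀ n, 0 < (w n).im)
    (hw : Tendsto (fun n => cweight (c n) (w n)) U atTop)
    (hb : Tendsto (fun n => 1 / (w n - c n)) U (𝓝 b)) : ‖b‖ ^ 2 * cL.im = b.im := by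
  have hci : Tendsto (fun n => (c n).im) U (𝓝 cL.im) :=
    (Complex.continuous_im.tendsto _).comp hc
  have h1 := ((hb.norm.pow 2).mul hci).sub ((Complex.continuous_im.tendsto _).comp hb)
  -- For finite `n` both sides of the circle equation differ by exactly `Im w / |w - c|²`, the
  -- quantity displayed here.
  have h2 : Tendsto (fun n => (cweight (c n) (w n))⁻¹ * (c n).im⁻¹) U (𝓝 (0 * cL.im⁻¹)) :=
    (tendsto_inv_atTop_zero.comp hw).mul (hci.inv₀ hcL.ne')
  have h3 := tendsto_nhds_unique (h1.congr' ?_) h2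
  · linarith
  filter_upwards [hw.eventually_ge_atTop 1] with n hn
  have h0 := half_im_le_norm (hcp n) (hwp n) hn
  have h4 := hcp n
  have h5 : 0 < ‖w n - c n‖ := by linarith
  have h6 := hwp n
  simp only [Function.comp_apply]
  have h7 : (1 / (w n - c n)).im = -(w n - c n).im / ‖w n - c n‖ ^ 2 := by
    rw [one_div, Complex.inv_im, Complex.normSq_eq_norm_sq]
  rw [h7, norm_div, norm_one, cweight, Complex.sub_im]
  field_simp
  ring

end limits

/-! ### Rotations and rigidity in Jensen's inequality. -/

theorem finRotate_pow_val {N : ℕ} [NeZero N] (k : ℕ) (j : Fin N) :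
    (((finRotate N ^ k) j : Fin N) : ℕ) = (j + k) % N := by
  induction k with
  | zero => simp [Nat.mod_eq_of_lt j.isLt]
  | succ k ih =>
    rw [pow_succ', Equiv.Perm.mul_apply, finRotate_apply, Fin.val_add, ih, Fin.val_one',
      ← Nat.add_mod, add_assoc]

theorem sum_finRotate_pow {N : ℕ} [NeZero N] (g : Fin N → ℝ) (j : Fin N) :
    ∑ k ∈ Finset.range N, g ((finRotate N ^ k) j) = ∑ i, g i := by
  rw [Finset.sum_range, ← Equiv.sum_comp (Equiv.addLeft j) g]
  refine Finset.sum_congr rfl fun k _ => congrArg g (Fin.ext ?_)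
  rw [finRotate_pow_val, Equiv.coe_addLeft, Fin.val_add]

/-- Rigidity in Jensen's inequality, averaged over a family of rearrangements. -/
theorem eq_of_sum_rpow_le {κ : Type*} [Fintype κ] {N : ℕ} {r : ℝ} (hr : 1 < r) {ω : κ → ℝ}
    (hω : ∀ j, 0 < ω j) (hω1 : ∑ j, ω j = 1) {σ : ℕ → Fin N → Fin N} {s : Finset ℕ}
    {t : κ → Fin N} (hσ : ∀ (g : Fin N → ℝ) j, ∑ k ∈ s, g (σ k j) = ∑ i, g i) {α : Fin N → ℝ}
    (hα : ∀ i, 0 ≤ α i) {ν : ℕ → ℝ} (hν0 : ∀ k, 0 ≤ ν k)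
    (hν : ∀ k, ν k ≤ ∑ j, ω j * α (σ k (t j))) (hsum : ∑ i, α i ^ r ≤ ∑ k ∈ s, ν k ^ r)
    {k : ℕ} (hk : k ∈ s) :
    ν k = ∑ j, ω j * α (σ k (t j)) ∧ ∀ j j', α (σ k (t j)) = α (σ k (t j')) := by
  have hf := strictConvexOn_rpow hr
  have h1 : ∀ k, ν k ^ r ≤ (∑ j, ω j * α (σ k (t j))) ^ r := fun k =>
    Real.rpow_le_rpow (hν0 k) (hν k) (by linarith)
  have h2 : ∀ k, (∑ j, ω j * α (σ k (t j))) ^ r ≤ ∑ j, ω j * α (σ k (t j)) ^ r := fun k => by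
    simpa using hf.convexOn.map_sum_le (t := Finset.univ) (w := ω) (p := fun j => α (σ k (t j)))
      (fun j _ => (hω j).le) hω1 (fun j _ => hα _)
  have h3 : ∑ k ∈ s, ∑ j, ω j * α (σ k (t j)) ^ r = ∑ i, α i ^ r := by
    rw [Finset.sum_comm]
    simp_rw [← Finset.mul_sum, hσ (fun i => α i ^ r), ← Finset.sum_mul, hω1, one_mul]
  -- The termwise bounds sum to equal totals, so each of them is an equality.
  have h4 : ν k ^ r = ∑ j, ω j * α (σ k (t j)) ^ r :=
    (Finset.sum_eq_sum_iff_of_le (fun k _ => (h1 k).trans (h2 k))).1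
      (le_antisymm (Finset.sum_le_sum fun k _ => (h1 k).trans (h2 k)) (h3.trans_le hsum)) k hk
  constructor
  · by_contra hne
    have := Real.rpow_lt_rpow (hν0 k) (lt_of_le_of_ne (hν k) hne) (by linarith : 0 < r)
    linarith [h2 k]
  · intro j j'
    refine hf.eq_of_le_map_sum (t := Finset.univ) (w := ω) (p := fun j => α (σ k (t j)))
      (fun j _ => hω j) hω1 (fun j _ => hα _) ?_ (Finset.mem_univ j) (Finset.mem_univ j')
    simpa using h4.ge.trans (h1 k)

/-! ### The fixed point near real energies and the boundary map. -/

theorem norm_zFix_le {M : ℕ} (hM : 2 ≤ M) (lam : ℍ) : ‖zFix M lam‖ ≤ 1 + ‖(lam : ℂ)‖ := by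
  have h := congrArg norm (zFix_mul (by omega : 0 < M) lam)
  rw [norm_mul, norm_neg, norm_one] at h
  have h1 := norm_sub_norm_le ((M : ℂ) * zFix M lam) (-(lam : ℂ))
  rw [sub_neg_eq_add, norm_neg, norm_mul, Complex.norm_natCast] at h1
  have hMr : (2 : ℝ) ≤ M := by exact_mod_cast hM
  by_contra! hc
  have h0 := norm_nonneg (lam : ℂ)
  have h2 : 1 < ‖(M : ℂ) * zFix M lam + lam‖ := by nlinarith
  nlinarith

/-- The limiting fixed point at a real energy inside the spectrum. -/
theorem limit_zFix {M : ℕ} (hM : 0 < M) {c : ℂ} {x : ℝ} (hx : x ^ 2 < 4 * M)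
    (hc : c * (M * c + x) = -1) (hc0 : 0 ≤ c.im) :
    0 < c.im ∧ c.re * (2 * M) = -x ∧ M * (c.re ^ 2 + c.im ^ 2) = 1 := by
  have hMr : (0 : ℝ) < M := by exact_mod_cast hM
  have h1 := congrArg Complex.re hc
  have h2 := congrArg Complex.im hc
  simp at h1 h2
  have hpos : 0 < c.im := by
    -- A real `c` would be a root of `M t² + x t + 1`, whose discriminant is negative.
    refine lt_of_le_of_ne hc0 fun h => ?_
    rw [← h] at h1
    nlinarith [sq_nonneg (2 * M * c.re + x)]
  have h3 : c.re * (2 * M) = -x := by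
    have : c.im * (c.re * (2 * M) + x) = 0 := by linear_combination h2
    rcases mul_eq_zero.1 this with h | h <;> linarith
  refine ⟨hpos, h3, ?_⟩
  linear_combination -h1 + c.re * h3

/-- An elliptic map has no fixed point on the boundary circle. -/
theorem no_boundary_fixed_point {M : ℕ} (hM : 0 < M) {c b : ℂ} {x : ℝ} (hx : x ^ 2 < 4 * M)
    (hc : c * (M * c + x) = -1) (hc0 : 0 ≤ c.im)
    (hb : b = (M * c + x) + (M * c + x) ^ 2 * (b / M)) (hbd : ‖b‖ ^ 2 * c.im = b.im) : False := by
  obtain ⟨hpos, h1, h2⟩ := limit_zFix hM hx hc hc0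
  have hMr : (0 : ℝ) < M := by exact_mod_cast hM
  have hMc : (M : ℂ) ≠ 0 := by exact_mod_cast hM.ne'
  have hSS : (starRingEnd ℂ) (M * c + x) * (M * c + x) = M := by
    rw [← Complex.normSq_eq_conj_mul_self, Complex.normSq_apply]
    have : (M * c + x : ℂ).re * (M * c + x : ℂ).re + (M * c + x : ℂ).im * (M * c + x : ℂ).im =
        (M : ℝ) := by
      simp
      have : x = -(c.re * (2 * M)) := by linarith
      rw [this]
      linear_combination (M : ℝ) * h2
    rw [this]
    simp
  have hS0 : (M * c + x : ℂ) ≠ 0 := fun h => by simp [h] at hc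
  -- As `|S|² = M`, the map is `b ↦ S + (S / conj S) b`, a rotation. Its only fixed point is `i / (2
  -- Im c)`, the centre of the boundary circle and hence not on it.
  have h3 : ((starRingEnd ℂ) (M * c + x) - (M * c + x)) * b = M := by
    have hb' : (M : ℂ) * b = M * (M * c + x) + (M * c + x) ^ 2 * b := by
      nth_rewrite 1 [hb]; field_simp
    refine mul_left_cancel₀ hS0 ?_
    linear_combination hb' + b * hSS
  have h4 := congrArg Complex.re h3
  have h5 := congrArg Complex.im h3
  simp at h4 h5
  have h6 : b.re = 0 := by
    rcases h5 with h | h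
    · nlinarith [mul_pos hMr hpos]
    · exact h
  rw [← Complex.normSq_eq_norm_sq, Complex.normSq_apply, h6] at hbd
  have h7 : 2 * c.im * b.im = 1 := by
    refine mul_left_cancel₀ hMr.ne' ?_
    linear_combination h4
  nlinarith

/-! ### Divergence of the total weight. -/

theorem dist_le_weight {M : ℕ} (hM : 0 < M) (lam z : ℍ) :
    dist z (⟨zFix M lam, zFix_im_pos hM lam⟩ : ℍ) ≤ weight M lam z + 2 := by
  rw [weight_eq_cosh hM]
  generalize dist z (⟨zFix M lam, zFix_im_pos hM lam⟩ : ℍ) = d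
  rw [Real.cosh_eq]
  linarith [Real.add_one_le_exp d, Real.exp_pos (-d)]

theorem weight_nonneg {M : ℕ} (hM : 0 < M) (lam z : ℍ) : 0 ≤ weight M lam z :=
  cweight_nonneg (zFix_im_pos hM lam) z.im_pos

/-- The total weight diverges along points that leave every compact set. -/
theorem tendsto_sum_weight {κ : Type*} [Fintype κ] {U : Ultrafilter ℕ} (hU : (U : Filter ℕ) ≤ atTop)
    {M : ℕ} (hM : 0 < M) {lam : ℕ → ℍ} {z : ℕ → κ → ℍ} {cL : ℂ} (hcL : 0 < cL.im)
    (hc : Tendsto (fun n => zFix M (lam n)) U (𝓝 cL))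
    (hz : ∀ n : ℕ, z n ∉ Metric.closedBall (fun _ => UpperHalfPlane.I) (n : ℝ)) :
    Tendsto (fun n => ∑ i, weight M (lam n) (z n i)) U atTop := by
  rw [tendsto_atTop]
  intro R
  by_contra hcon
  have h1 : ∀ᶠ n in (U : Filter ℕ), ¬ R ≤ ∑ i, weight M (lam n) (z n i) :=
    Ultrafilter.eventually_not.2 hcon
  have h2 : Tendsto (fun n => (⟨zFix M (lam n), zFix_im_pos hM (lam n)⟩ : ℍ)) U
      (𝓝 (⟨cL, hcL⟩ : ℍ)) := by
    rw [UpperHalfPlane.isEmbedding_coe.tendsto_nhds_iff]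
    exact hc
  have h3 := (h2.dist (tendsto_const_nhds (x := UpperHalfPlane.I))).eventually_le_const
    (lt_add_one _)
  set D := dist (⟨cL, hcL⟩ : ℍ) UpperHalfPlane.I + 1
  obtain ⟨m, hm⟩ := exists_nat_ge (|R| + 2 + D)
  have h4 : ∀ᶠ n in (U : Filter ℕ), m ≤ n := hU (eventually_ge_atTop m)
  obtain ⟨n, hn1, hn3, hn4⟩ := (h1.and (h3.and h4)).exists
  have hD0 : 0 ≤ D := by positivity
  refine hz n (Metric.mem_closedBall.2 ?_)
  refine (dist_pi_le_iff (by positivity)).2 fun i => ?_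
  have h5 := dist_triangle (z n i) (⟨zFix M (lam n), zFix_im_pos hM (lam n)⟩ : ℍ) UpperHalfPlane.I
  have h6 := dist_le_weight hM (lam n) (z n i)
  have h7 := Finset.single_le_sum (f := fun i => weight M (lam n) (z n i))
    (fun i _ => weight_nonneg hM _ _) (Finset.mem_univ i)
  have h8 : (m : ℝ) ≤ n := by exact_mod_cast hn4
  have h9 := le_abs_self R

  linarith [not_le.1 hn1]

/-! ### The two-step map. -/

/-- The coordinates used by `phiTwice`: first those of the inner map, then those of the outer. -/
def slot (m : ℕ) : Fin (m + 1) ⊕ Fin m → Fin (2 * (m + 1) - 1)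
  | Sum.inl i => ⟨i, by omega⟩
  | Sum.inr j => ⟨m + 1 + (j.succ : ℕ) - 1, by have := j.isLt; simp; omega⟩

/-- The Jensen weights attached to the coordinates of `phiTwice`. -/
def slotWeight (m : ℕ) : Fin (m + 1) ⊕ Fin m → ℝ
  | Sum.inl _ => 1 / ((m + 1 : ℕ) : ℝ) * (1 / ((m + 1 : ℕ) : ℝ))
  | Sum.inr _ => 1 / ((m + 1 : ℕ) : ℝ)

theorem slotWeight_pos (m : ℕ) (j) : 0 < slotWeight m j := by
  rcases j with j | j <;> simp only [slotWeight] <;> positivity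

theorem sum_slotWeight_mul (m : ℕ) (g : Fin (m + 1) ⊕ Fin m → ℝ) :
    ∑ j, slotWeight m j * g j = 1 / ((m + 1 : ℕ) : ℝ) *
      (1 / ((m + 1 : ℕ) : ℝ) * ∑ i, g (Sum.inl i) + ∑ j, g (Sum.inr j)) := by
  simp only [Fintype.sum_sum_type, slotWeight, ← Finset.mul_sum]
  ring

theorem sum_slotWeight (m : ℕ) : ∑ j, slotWeight m j = 1 := by
  have h := sum_slotWeight_mul m (fun _ => 1)
  simp only [mul_one, Finset.sum_const, Finset.card_univ, Fintype.card_fin, nsmul_eq_mul] at h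
  rw [h]
  push_cast
  field_simp
  ring

theorem slot_surjective (m : ℕ) : Function.Surjective (slot m) := fun i => by
  by_cases h : (i : ℕ) < m + 1
  · exact ⟨Sum.inl ⟨i, h⟩, rfl⟩
  · have := i.isLt
    refine ⟨Sum.inr ⟨i - (m + 1), by omega⟩, Fin.ext ?_⟩
    simp only [slot, Fin.val_succ]
    omega

/-- The inner application of `phi` in `phiTwice`. -/
def phiInner {m : ℕ} (z : Fin (2 * (m + 1) - 1) → ℍ) (q : ℝ) (lam : ℍ) : ℍ :=
  phi (fun i => z (slot m (Sum.inl i))) q lam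

/-- The arguments of the outer application of `phi` in `phiTwice`. -/
def outerArgs {m : ℕ} (z : Fin (2 * (m + 1) - 1) → ℍ) (q : ℝ) (lam : ℍ) : Fin (m + 1) → ℍ :=
  Fin.cons (phiInner z q lam) fun j => z (slot m (Sum.inr j))

theorem phiTwice_eq {m : ℕ} (z : Fin (2 * (m + 1) - 1) → ℍ) (q₁ q₂ : ℝ) (lam : ℍ) :
    phiTwice z q₁ q₂ lam = phi (outerArgs z q₁ lam) q₂ lam := by
  unfold phiTwice
  congr 1
  funext j
  refine Fin.cases ?_ (fun j => ?_) j
  · rfl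
  · rw [if_neg (by simp)]
    rfl

section limits

variable {ι : Type*} {U : Ultrafilter ι} {m : ℕ} {z : ι → Fin (2 * (m + 1) - 1) → ℍ}
  {q₁ q₂ T : ι → ℝ} {lam : ι → ℍ} {cL : ℂ}

theorem exists_tendsto_weight_phiTwice
    (hc : Tendsto (fun n => zFix (m + 1) (lam n)) U (𝓝 cL)) (hcL : 0 < cL.im)
    (hq₁ : Tendsto q₁ U (𝓝 0)) (hq₂ : Tendsto q₂ U (𝓝 0)) (hT0 : ∀ n, 0 ≤ T n)
    (hT : Tendsto T U atTop) {α : Fin (2 * (m + 1) - 1) → ℝ}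
    (hw : ∀ i, Tendsto (fun n => weight (m + 1) (lam n) (z n i) / T n) U (𝓝 (α i))) :
    ∃ κ ν, 0 ≤ ν ∧ κ ≤ 1 / ((m + 1 : ℕ) : ℝ) * ∑ i, α (slot m (Sum.inl i)) ∧
      ν ≤ 1 / ((m + 1 : ℕ) : ℝ) * (κ + ∑ j, α (slot m (Sum.inr j))) ∧
      Tendsto (fun n => weight (m + 1) (lam n) (phiInner (z n) (q₁ n) (lam n)) / T n) U (𝓝 κ) ∧
      Tendsto (fun n => weight (m + 1) (lam n) (phiTwice (z n) (q₁ n) (q₂ n) (lam n)) / T n) U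
        (𝓝 ν) := by
  obtain ⟨κ, -, hκ, hκt⟩ := exists_tendsto_weight_phi (z := fun n i => z n (slot m (Sum.inl i)))
    m.succ_pos hc hcL hq₁ hT0 hT (fun i => hw _)
  obtain ⟨ν, hν0, hν, hνt⟩ := exists_tendsto_weight_phi
    (z := fun n => outerArgs (z n) (q₁ n) (lam n)) (α := Fin.cons κ fun j => α (slot m (Sum.inr j)))
    m.succ_pos hc hcL hq₂ hT0 hT (fun j => Fin.cases hκt (fun j => hw _) j)
  refine ⟨κ, ν, hν0, hκ, ?_, hκt, ?_⟩
  · simpa [Fin.sum_univ_succ] using hν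
  · simpa only [phiTwice_eq] using hνt

/-- Losing no weight overall means losing none in either step, so one-step rigidity applies to both.
The inner value is itself an outer argument, hence the outer coordinates share the limit obtained
from `b`. -/
theorem exists_tendsto_inv_phiTwice
    (hc : Tendsto (fun n => zFix (m + 1) (lam n)) U (𝓝 cL)) (hcL : 0 < cL.im)
    (hq₁ : Tendsto q₁ U (𝓝 0)) (hq₂ : Tendsto q₂ U (𝓝 0)) (hT0 : ∀ n, 0 ≤ T n)
    (hT : Tendsto T U atTop) {α : ℝ} (hα : 0 < α)
    (hw : ∀ i, Tendsto (fun n => weight (m + 1) (lam n) (z n i) / T n) U (𝓝 α))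
    (hφ : Tendsto (fun n => weight (m + 1) (lam n) (phiTwice (z n) (q₁ n) (q₂ n) (lam n)) / T n) U
      (𝓝 α)) {lL : ℂ} (hlam : Tendsto (fun n => (lam n : ℂ)) U (𝓝 lL)) :
    ∃ b, (∀ i, Tendsto (fun n => 1 / ((z n (slot m (Sum.inl i)) : ℂ) - zFix (m + 1) (lam n))) U
        (𝓝 b)) ∧
      ∀ j, Tendsto (fun n => 1 / ((z n (slot m (Sum.inr j)) : ℂ) - zFix (m + 1) (lam n))) U
        (𝓝 (((m + 1 : ℕ) * cL + lL) + ((m + 1 : ℕ) * cL + lL) ^ 2 * (b / (m + 1 : ℕ)))) := by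
  obtain ⟨κ, ν, -, hκ, hν, hκt, hνt⟩ := exists_tendsto_weight_phiTwice hc hcL hq₁ hq₂ hT0 hT hw
  have hνα : ν = α := tendsto_nhds_unique hνt hφ
  -- `κ` is at most the mean `α`, and the outer bound `α ≤ (κ + m α) / (m + 1)` gives the reverse.
  have hκα : κ = α := by
    rw [hνα] at hν
    simp only [Finset.sum_const, Finset.card_univ, Fintype.card_fin, nsmul_eq_mul] at hκ hν
    have hm : (0 : ℝ) < ((m + 1 : ℕ) : ℝ) := by positivity
    refine le_antisymm (by rwa [← mul_assoc, one_div_mul_cancel hm.ne', one_mul] at hκ) ?_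
    rw [one_div, ← div_eq_inv_mul, le_div_iff₀ hm] at hν
    push_cast at hν
    linarith
  subst hκα
  obtain ⟨b, hb, hbφ⟩ := exists_tendsto_inv_sub (z := fun n i => z n (slot m (Sum.inl i)))
    m.succ_pos hc hcL hq₁ hT hα (fun i => hw _) hκt hlam
  obtain ⟨b', hb', -⟩ := exists_tendsto_inv_sub (z := fun n => outerArgs (z n) (q₁ n) (lam n))
    m.succ_pos hc hcL hq₂ hT hα (fun j => Fin.cases hκt (fun j => hw _) j)
    (by simpa only [phiTwice_eq] using hφ) hlam
  have h0 : b' = _ := tendsto_nhds_unique (hb' 0) hbφ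
  exact ⟨b, hb, fun j => h0 ▸ hb' j.succ⟩

end limits

/-! ### The contradiction. -/

/-- Points leaving every compact set cannot have asymptotic contraction ratio at least one. -/
theorem false_of_asymptotic_ratio {U : Ultrafilter ℕ} (hU : (U : Filter ℕ) ≤ atTop) {m : ℕ}
    (hm : 0 < m) {E p : ℝ} (hE : E ^ 2 < 4 * ((m + 1 : ℕ) : ℝ)) (hp : 0 < p) {ε : ℕ → ℝ}
    (hε : Tendsto ε U (𝓝 0)) (hε1 : ∀ n, ε n ≤ 1) {z : ℕ → Fin (2 * (m + 1) - 1) → ℍ}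
    {q₁ q₂ : ℕ → ℝ} {lam : ℕ → ℍ}
    (hz : ∀ n : ℕ, z n ∉ Metric.closedBall (fun _ => UpperHalfPlane.I) (n : ℝ))
    (hq₁ : Tendsto q₁ U (𝓝 0)) (hq₂ : Tendsto q₂ U (𝓝 0)) (hlam : ∀ n, lam n ∈ strip E (ε n))
    (hmu : ∀ n, 0 < weightSum (m + 1) p (z n) (lam n) →
      1 - ε n < mu3 (m + 1) p (z n) (q₁ n) (q₂ n) (lam n)) : False := by
  have hM : 0 < m + 1 := m.succ_pos
  have hN : NeZero (2 * (m + 1) - 1) := ⟨by omega⟩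
  have hlb : ∀ n, ‖(lam n : ℂ)‖ ≤ E + 1 := fun n => by
    have h1 : |(lam n : ℂ).re| ≤ E := abs_le.2 (hlam n).1
    have h2 : |(lam n : ℂ).im| ≤ 1 := by
      exact (abs_of_pos (lam n).im_pos).trans_le ((hlam n).2.trans (hε1 n))
    exact (Complex.norm_le_abs_re_add_abs_im _).trans (by linarith)
  obtain ⟨lL, hlL⟩ := exists_tendsto_of_norm_le U (Eventually.of_forall hlb)
  have hcb : ∀ n, ‖zFix (m + 1) (lam n)‖ ≤ 1 + (E + 1) := fun n =>
    (norm_zFix_le (by omega) (lam n)).trans (by linarith [hlb n])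
  obtain ⟨cL, hc⟩ := exists_tendsto_of_norm_le U (Eventually.of_forall hcb)
  have hre : Tendsto (fun n => (lam n : ℂ).re) U (𝓝 lL.re) :=
    (Complex.continuous_re.tendsto _).comp hlL
  have him : Tendsto (fun n => (lam n : ℂ).im) U (𝓝 lL.im) :=
    (Complex.continuous_im.tendsto _).comp hlL
  have him0 : lL.im = 0 := le_antisymm
    (le_of_tendsto_of_tendsto' him hε fun n => (hlam n).2)
    (ge_of_tendsto' him fun n => (lam n).im_pos.le)
  have hlr : lL = (lL.re : ℂ) := by apply Complex.ext <;> simp [him0]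
  have hx : lL.re ^ 2 < 4 * ((m + 1 : ℕ) : ℝ) := by
    have h1 := ge_of_tendsto' hre fun n => (hlam n).1.1
    have h2 := le_of_tendsto' hre fun n => (hlam n).1.2
    exact (sq_le_sq' h1 h2).trans_lt hE
  -- The limit of `z_λ` is identified by its quadratic equation, so continuity of the square root
  -- plays no role.
  have hcfix : cL * ((m + 1 : ℕ) * cL + (lL.re : ℂ)) = -1 := by
    rw [← hlr]
    refine tendsto_nhds_unique (hc.mul ((hc.const_mul _).add hlL)) ?_
    simp_rw [zFix_mul hM]
    exact tendsto_const_nhds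
  have hc0 : 0 ≤ cL.im := ge_of_tendsto' ((Complex.continuous_im.tendsto _).comp hc)
    fun n => (zFix_im_pos hM (lam n)).le
  have hcL := (limit_zFix hM hx hcfix hc0).1
  set T : ℕ → ℝ := fun n => ∑ i, weight (m + 1) (lam n) (z n i) with hTdef
  have hT : Tendsto T U atTop := tendsto_sum_weight hU hM hcL hc hz
  have hT0 : ∀ n, 0 ≤ T n := fun n => Finset.sum_nonneg fun i _ => weight_nonneg hM _ _
  have hTp : ∀ᶠ n in (U : Filter ℕ), 0 < T n := hT.eventually_gt_atTop 0
  have hex : ∀ i, ∃ a, 0 ≤ a ∧ a ≤ 1 ∧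
      Tendsto (fun n => weight (m + 1) (lam n) (z n i) / T n) U (𝓝 a) := fun i => by
    refine exists_tendsto_of_le U (fun n => div_nonneg (weight_nonneg hM _ _) (hT0 n))
      (fun n => ?_) tendsto_const_nhds
    exact div_le_one_of_le₀ (Finset.single_le_sum
      (f := fun i => weight (m + 1) (lam n) (z n i)) (fun i _ => weight_nonneg hM _ _)
      (Finset.mem_univ i)) (hT0 n)
  choose α hα0 _ hα using hex
  have hαsum : ∑ i, α i = 1 := by
    refine tendsto_nhds_unique (tendsto_finsetSum Finset.univ fun i _ => hα i)
      (tendsto_const_nhds.congr' ?_)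
    filter_upwards [hTp] with n hn
    rw [← Finset.sum_div, div_self hn.ne']
  set σ : ℕ → Fin (2 * (m + 1) - 1) → Fin (2 * (m + 1) - 1) :=
    fun k i => (finRotate (2 * (m + 1) - 1) ^ k) i with hσdef
  have hstep := fun k => exists_tendsto_weight_phiTwice (z := fun n i => z n (σ k i))
    (α := fun i => α (σ k i)) hc hcL hq₁ hq₂ hT0 hT (fun i => hα _)
  choose κ ν hν0 hκ hν hκt hνt using hstep
  have hr : (1 : ℝ) < 1 + p := by linarith
  have hsum : ∑ i, α i ^ (1 + p) ≤ ∑ k ∈ Finset.range (2 * (m + 1) - 1), ν k ^ (1 + p) := by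
    have h1 : Tendsto (fun n => (1 - ε n) *
        ∑ i, (weight (m + 1) (lam n) (z n i) / T n) ^ (1 + p)) U
        (𝓝 ((1 - 0) * ∑ i, α i ^ (1 + p))) :=
      (tendsto_const_nhds.sub hε).mul (tendsto_finsetSum _ fun i _ =>
        (hα i).rpow_const (Or.inr (by linarith)))
    rw [sub_zero, one_mul] at h1
    refine le_of_tendsto_of_tendsto h1 (tendsto_finsetSum _ fun k _ =>
        (hνt k).rpow_const (Or.inr (by linarith))) ?_
    filter_upwards [hTp] with n hn
    -- A vanishing sum of powers would make every weight, and so `T n`, vanish.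
    have hws : 0 < weightSum (m + 1) p (z n) (lam n) := by
      by_contra hcon
      have h0 := (Finset.sum_eq_zero_iff_of_nonneg fun i _ =>
        Real.rpow_nonneg (weight_nonneg hM (lam n) (z n i)) (1 + p)).1
        (le_antisymm (not_lt.1 hcon)
          (Finset.sum_nonneg fun i _ => Real.rpow_nonneg (weight_nonneg hM _ _) _))
      have : T n = 0 := Finset.sum_eq_zero fun i hi =>
        ((Real.rpow_eq_zero_iff_of_nonneg (weight_nonneg hM _ _)).1 (h0 i hi)).1
      exact hn.ne' this
    have h2 := hmu n hws
    rw [mu3, ← Finset.sum_div, lt_div_iff₀ hws, weightSum] at h2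
    have h3 : ∀ w : ℍ, (weight (m + 1) (lam n) w / T n) ^ (1 + p) =
        weight (m + 1) (lam n) w ^ (1 + p) / T n ^ (1 + p) := fun w =>
      Real.div_rpow (weight_nonneg hM _ _) hn.le _
    simp only [h3]
    rw [← Finset.sum_div, ← Finset.sum_div, mul_div_assoc']
    exact div_le_div_of_nonneg_right h2.le (Real.rpow_nonneg hn.le _)
  have hrigid := fun k hk => eq_of_sum_rpow_le (k := k) hr (slotWeight_pos m) (sum_slotWeight m)
    (σ := σ) (t := slot m) (fun g j => sum_finRotate_pow g j) hα0 hν0 (fun k => by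
      rw [sum_slotWeight_mul m fun j => α (σ k (slot m j))]
      refine (hν k).trans (mul_le_mul_of_nonneg_left ?_ (by positivity))
      linarith [hκ k]) hsum hk
  -- Two consecutive rotations suffice from here on.
  have hmem : ∀ k, k < 2 → k ∈ Finset.range (2 * (m + 1) - 1) := fun k hk =>
    Finset.mem_range.2 (by omega)
  have hconst : ∀ i j, α i = α j := fun i j => by
    obtain ⟨i', rfl⟩ := slot_surjective m i
    obtain ⟨j', rfl⟩ := slot_surjective m j
    simpa [hσdef] using (hrigid 0 (hmem 0 (by norm_num))).2 i' j'
  have hαeq : ∀ i, α i = α 0 := fun i => hconst i 0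
  have hαpos : 0 < α 0 := by
    refine lt_of_le_of_ne (hα0 0) fun h => ?_
    simp [hαeq, ← h] at hαsum
  have hνeq : ∀ k, k < 2 → ν k = α 0 := fun k hk => by
    rw [(hrigid k (hmem k hk)).1]
    simp_rw [hαeq (σ k _)]
    rw [← Finset.sum_mul, sum_slotWeight, one_mul]
  have hinv := fun k hk => exists_tendsto_inv_phiTwice (z := fun n i => z n (σ k i)) hc hcL hq₁ hq₂
    hT0 hT hαpos (fun i => hαeq (σ k i) ▸ hα (σ k i)) (hνeq k hk ▸ hνt k) hlL
  obtain ⟨b, hb, hb'⟩ := hinv 0 (by norm_num)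
  obtain ⟨d, hd, -⟩ := hinv 1 (by norm_num)
  have hσ0 : ∀ i, σ 0 i = i := fun i => by simp [hσdef]
  -- The inner block shifted by one still meets the original inner block, as `m ≥ 1`, so the limits
  -- `b` and `d` agree. By `e2` it also reaches the first outer coordinate, so `d` equals the image
  -- of `b`.
  have e1 : σ 1 (slot m (Sum.inl 0)) = slot m (Sum.inl ⟨1, by omega⟩) := by
    apply Fin.ext
    simp only [hσdef, finRotate_pow_val, slot]
    rw [Nat.mod_eq_of_lt] <;> simp <;> omega
  have e2 : σ 1 (slot m (Sum.inl ⟨m, by omega⟩)) = slot m (Sum.inr ⟨0, hm⟩) := by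
    apply Fin.ext
    simp only [hσdef, finRotate_pow_val, slot]
    rw [Nat.mod_eq_of_lt] <;> (try simp) <;> omega
  simp only [hσ0] at hb hb'
  have hbd : b = d := tendsto_nhds_unique (hb ⟨1, by omega⟩) (e1 ▸ hd 0)
  have hfix := tendsto_nhds_unique (e2 ▸ hd ⟨m, by omega⟩) (hb' ⟨0, hm⟩)
  rw [← hbd, hlr] at hfix
  refine no_boundary_fixed_point hM hx hcfix hc0 hfix (boundary_eq hc hcL
    (fun n => zFix_im_pos hM (lam n)) (fun n => (z n (slot m (Sum.inl 0))).im_pos) ?_ (hb 0))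
  exact tendsto_atTop_of_tendsto_div hαpos hT (hαeq (slot m (Sum.inl 0)) ▸ hα _)

end AndersonTree

end

theorem mainTheorem4 (M : ℕ) (hM : 2 ≤ M) (E p : ℝ) (hE0 : 0 < E) (hE : E < 2 * √(M : ℝ))
    (hp0 : 0 < p) (hp1 : p < 1) :
    ∃ ε > (0 : ℝ), ∃ η₁ > (0 : ℝ), ∃ ε₀ > (0 : ℝ),
      ∃ K : Set (Fin (2 * M - 1) → UpperHalfPlane), IsCompact K ∧
        ∀ z ∉ K, ∀ q₁ ∈ Set.Icc (-η₁) η₁, ∀ q₂ ∈ Set.Icc (-η₁) η₁,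
          ∀ lam ∈ AndersonTree.strip E ε₀,
            0 < AndersonTree.weightSum M p z lam ∧
              AndersonTree.mu3 M p z q₁ q₂ lam ≤ 1 - ε := by
  by_contra hcon
  push Not at hcon
  have hpos : ∀ n : ℕ, (0 : ℝ) < 1 / (n + 1) := fun n => by positivity
  -- All three constants are `1 / (n + 1)` and the compact set is the ball of radius `n`. The
  -- negation is an implication from positivity of the denominator, so it also covers failure of
  -- positivity.
  have h := fun n : ℕ => hcon _ (hpos n) _ (hpos n) _ (hpos n) _
    (isCompact_closedBall (fun _ => UpperHalfPlane.I) (n : ℝ))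
  choose z hz q₁ hq₁ q₂ hq₂ lam hlam hmu using h
  obtain ⟨m, rfl⟩ : ∃ m, M = m + 1 := ⟨M - 1, by omega⟩
  have hε : Filter.Tendsto (fun n : ℕ => 1 / ((n : ℝ) + 1)) (Filter.hyperfilter ℕ) (nhds 0) :=
    tendsto_one_div_add_atTop_nhds_zero_nat.mono_left Nat.hyperfilter_le_atTop
  refine AndersonTree.false_of_asymptotic_ratio Nat.hyperfilter_le_atTop (by omega) ?_ hp0 hε
    (fun n => ?_) hz (squeeze_zero_norm (fun n => abs_le.2 (hq₁ n)) hε)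
    (squeeze_zero_norm (fun n => abs_le.2 (hq₂ n)) hε) hlam hmu
  · have h1 := pow_lt_pow_left₀ hE hE0.le (two_ne_zero)
    rw [mul_pow, Real.sq_sqrt (by positivity)] at h1
    linarith
  · rw [div_le_one (by positivity)]
    linarith [(Nat.cast_nonneg n : (0 : ℝ) ≤ n)]
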